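/- All differential fields have characteristic zero. Let $F$ be a differential field whose field of constants is algebraically closed. A differential field extension $E$ of a differential field $k$ is called an antiderivative extension of $k$ if $E$ has the same constants as $k$ and $E=k(\zeta_1,\dots,\zeta_n)$ for some $n\ge 0$ and $\zeta_i\in E$ with $\zeta_i'\in k$ for all $i$. Elements $\zeta_1,\dots,\zeta_n\in E$ are iterated antiderivatives of $k$ if $\zeta_i'\in k(\zeta_1,\dots,\zeta_{i-1})$ for all $i$, and $E$ is an iterated antiderivative extension of $k$ if $E$ has the same constants as $k$ and $E=k(\zeta_1,\dots,\zeta_n)$ for some iterated antiderivatives $\zeta_1,\dots,\zeta_n$ of $k$, $n\ge 0$. For a differential subfield $K$ of $E$, $G(E|K)$ is the group of field automorphisms of $E$ that fix $K$ pointwise and commute with the derivation. For a set $H\subseteq G(E|F)$ of pairwise commuting automorphisms, $\eta_1,\dots,\eta_t\in E$ are called $H$-invariant iterated antiderivatives of $F$ if they are iterated antiderivatives of $F$, are algebraically independent over $F$, and each field $F(\eta_1,\dots,\eta_i)$, $0\le i\le t$, is mapped into itself by every element of $H$. Finally $F\langle u\rangle=F(u,u',u'',\dots)$. Let $E$ be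 an iterated antiderivative extension of $F$, let $K$ be a differential subfield of $E$ containing $F$ such that $E$ is an antiderivative extension of $K$, and let $G=G(E|K)$. Then the elements of $G$ commute pairwise, and there are $t\ge 0$ and $G$-invariant iterated antiderivatives $\eta_1,\dots,\eta_t$ of $F$ such that $E=F(\eta_1,\dots,\eta_t)$. Moreover, for any such $\eta_1,\dots,\eta_t$ let $L^*=F(\eta_1,\dots,\eta_{t-1})$ (with $L^*=F$ if $t\le 1$). Then either $K\subseteq L^*$, or $t\ge 1$ and there is an element $a\in L^*$ with $\eta_t+a\in K$. If $t\ge 1$, then for every $a\in L^*$ with $\eta_t+a\in K$ one has $\eta_t+a\notin F\langle\eta_t'+a'\rangle$, and $F\langle\eta_t'+a'\rangle$ is a proper differential subfield of $K$. -/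

import Mathlib

open scoped Differential

namespace DiffField

/-- The field of constants of a differential field. -/
def constants (F : Type*) [Field F] [Differential F] : Subfield F where
  carrier := {x | x′ = 0}
  mul_mem' := by
    intro a b ha hb
    simp only [Set.mem_ofPred_eq] at *
    simp [Derivation.leibniz, ha, hb]
  one_mem' := by simp
  add_mem' := by
    intro a b ha hb
    simp only [Set.mem_ofPred_eq] at *
    simp [ha, hb]
  zero_mem' := by simp
  neg_mem' := by
    intro a ha
    simp only [Set.mem_ofPred_eq] at *
    simp [ha]
  inv_mem' := by
    intro a ha
    simp only [Set.mem_ofPred_eq] at *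
    simp [Derivation.leibniz_inv, ha]

section Extensions

variable (k : Type*) {E : Type*} [Field k] [Field E] [Algebra k E] [Differential E]

/-- `η₁, …, ηₙ ∈ E` are iterated antiderivatives of `k`:
`ηᵢ′ ∈ k(η₁, …, ηᵢ₋₁)` for every `i` (for `i = 1` this field is `k`). -/
def IsIteratedAntiderivatives {n : ℕ} (η : Fin n → E) : Prop :=
  ∀ i, (η i)′ ∈ IntermediateField.adjoin k (η '' {j | j < i})

variable (E)

/-- `E` is an antiderivative extension of `k`: there are no new constants, and
`E = k(ζ₁, …, ζₙ)` with `ζᵢ′ ∈ k` for every `i`. -/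
def IsAntiderivativeExtension : Prop :=
  Differential.ContainConstants k E ∧
    ∃ (n : ℕ) (ζ : Fin n → E), (∀ i, (ζ i)′ ∈ (algebraMap k E).range) ∧
      IntermediateField.adjoin k (Set.range ζ) = ⊤

/-- `E` is an iterated antiderivative extension of `k`: there are no new constants, and
`E = k(ζ₁, …, ζₙ)` with iterated antiderivatives `ζ₁, …, ζₙ` of `k`. -/
def IsIteratedAntiderivativeExtension : Prop :=
  Differential.ContainConstants k E ∧
    ∃ (n : ℕ) (ζ : Fin n → E), IsIteratedAntiderivatives k ζ ∧
      IntermediateField.adjoin k (Set.range ζ) = ⊤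

end Extensions

section Subfields

variable {F E : Type*} [Field F] [Field E] [Algebra F E] [Differential E]

/-- An intermediate field that is closed under the derivation. -/
def IsDifferentialSubfield (K : IntermediateField F E) : Prop :=
  ∀ x ∈ K, x′ ∈ K

/-- The differential field `F⟨u⟩ = F(u, u′, u′′, …)`. -/
def diffAdjoin (F : Type*) {E : Type*} [Field F] [Field E] [Algebra F E] [Differential E]
    (u : E) : IntermediateField F E :=
  IntermediateField.adjoin F
    (Set.range fun n : ℕ => (fun y : E => y′)^[n] u)

/-- The group `G(E|K)` of the field automorphisms of `E` that fix every element of `K` and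
commute with the derivation (as `K` contains `F`, they are `F`-algebra automorphisms). -/
def diffGal (K : IntermediateField F E) : Subgroup (E ≃ₐ[F] E) where
  carrier := {σ | (∀ x ∈ K, σ x = x) ∧ ∀ y : E, (σ y)′ = σ (y′)}
  mul_mem' := by
    rintro σ τ ⟨h₁, h₂⟩ ⟨h₃, h₄⟩
    refine ⟨fun x hx => ?_, fun y => ?_⟩
    · rw [AlgEquiv.mul_apply, h₃ x hx, h₁ x hx]
    · rw [AlgEquiv.mul_apply, AlgEquiv.mul_apply, h₂, h₄]
  one_mem' := ⟨fun _ _ => rfl, fun _ => rfl⟩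
  inv_mem' := by
    rintro σ ⟨h₁, h₂⟩
    refine ⟨fun x hx => ?_, fun y => ?_⟩
    · exact (AlgEquiv.symm_apply_eq σ).2 (h₁ x hx).symm
    · refine ((AlgEquiv.symm_apply_eq σ).2 ?_).symm
      have h := h₂ (σ.symm y)
      rw [AlgEquiv.apply_symm_apply] at h
      exact h

/-- `η₁, …, ηₙ` are `H`-invariant iterated antiderivatives of `F`, where `H` is a set of
commuting differential automorphisms of `E` over `F`: they are iterated antiderivatives of `F`,
algebraically independent over `F`, and `H` maps each of the fields `F`, `F(η₁)`,
`F(η₁, η₂)`, …, `F(η₁, …, ηₙ)` into itself. -/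
structure IsInvariantIteratedAntiderivatives (H : Set (E ≃ₐ[F] E)) {n : ℕ}
    (η : Fin n → E) : Prop where
  differential : H ⊆ diffGal (⊥ : IntermediateField F E)
  commute : ∀ σ ∈ H, ∀ τ ∈ H, σ * τ = τ * σ
  iterated : IsIteratedAntiderivatives F η
  algebraicIndependent : AlgebraicIndependent F η
  invariant : ∀ m ≤ n, ∀ σ ∈ H,
    ∀ x ∈ IntermediateField.adjoin F (η '' {j | (j : ℕ) < m}),
      σ x ∈ IntermediateField.adjoin F (η '' {j | (j : ℕ) < m})

end Subfields

end DiffField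

/-! Write `G` for `diffGal K`. Each generator `ζᵢ` of `E` over `K` has derivative in `K`, so every
`σ ∈ G` translates it by a constant, which lies in `F`. Hence `G` is commutative, and `σ ^ n` moves
each element along a rational function of `n`. This rules out eigenvalues other than `1` modulo an
invariant field (`eigenvalue_eq_one`). Shift automorphisms show that the fixed field of `G` is `K`
(`mem_of_fixed`).

Existence: let `M ≠ E` be a `G`-invariant differential subfield. The antiderivatives of elements of
`M`, taken modulo `M`, form a nonzero finite-dimensional space over the constants of `F`, on which
`G` acts by commuting maps. As the constants are algebraically closed there is a common eigenvector.
Its eigenvalues are `1`, so it lifts to some `η ∉ M` with `σ η - η ∈ M`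
(`exists_invariant_antiderivative`). Such an `η` is transcendental over `M`, so adjoining these one
at a time must exhaust `E`, whose transcendence degree is finite.

Dichotomy: let `y` be the last antiderivative, so `E = L(y)` and `σ y - y ∈ L`. An element of `K`
outside `L` yields a nonconstant `G`-fixed polynomial in `y` over `L` (`exists_fixed_polynomial`).
Formal differentiation in `y` preserves being fixed, and lowers the degree to one. The quotient of
the resulting `α y + β` by `α` is `y + a`, and it is fixed, hence in `K`. The last claim holds
because `y′ + a′` generates a differential field inside `L`, whereas `y + a ∉ L`. -/

namespace DiffField

open Polynomial IntermediateField

/-! ### Differential subfields and algebraic antiderivatives -/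

section Generic

variable {k E : Type*} [Field k] [Field E] [Algebra k E]

/-- A differential subfield is a differential field. -/
@[reducible]
def IsDifferentialSubfield.toDifferential [Differential E] {N : IntermediateField k E}
    (hN : IsDifferentialSubfield N) : Differential N where
  deriv := Derivation.mk'
    { toFun := fun x => ⟨(x : E)′, hN x x.2⟩
      map_add' := fun x y => by ext; simp
      map_smul' := fun n x => by ext; simp }
    (fun x y => by ext; simp)

theorem IsDifferentialSubfield.differentialAlgebra [Differential E] {N : IntermediateField k E}
    (hN : IsDifferentialSubfield N) :
    letI := hN.toDifferential
    DifferentialAlgebra N E :=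
  letI := hN.toDifferential
  ⟨fun _ => rfl⟩

theorem containConstants_intermediateField [Differential E] [Differential.ContainConstants k E]
    (N : IntermediateField k E) : Differential.ContainConstants N E where
  mem_range_of_deriv_eq_zero {x} h := by
    obtain ⟨c, rfl⟩ := mem_range_of_deriv_eq_zero k h
    exact ⟨algebraMap k N c, rfl⟩

theorem isDifferentialSubfield_adjoin [Differential k] [Differential E] [DifferentialAlgebra k E]
    {S : Set E} (hS : ∀ s ∈ S, s′ ∈ adjoin k S) : IsDifferentialSubfield (adjoin k S) := by
  intro x hx
  induction hx using adjoin_induction with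
  | mem x hx => exact hS x hx
  | algebraMap x => rw [deriv_algebraMap]; exact IntermediateField.algebraMap_mem _ _
  | add x y hx hy hx' hy' => rw [map_add]; exact add_mem hx' hy'
  | inv x hx hx' =>
    rw [Derivation.leibniz_inv]
    simp only [smul_eq_mul]
    exact mul_mem (neg_mem (pow_mem (inv_mem hx) 2)) hx'
  | mul x y hx hy hx' hy' =>
    rw [Derivation.leibniz]
    exact add_mem (mul_mem hx hy') (mul_mem hy hx')

/-- A homomorphism that commutes with the derivation on generators commutes with it. -/
theorem deriv_map_of_adjoin_eq_top [Differential k] [Differential E] [DifferentialAlgebra k E]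
    {S : Set E} (hS : adjoin k S = ⊤) (σ : E →ₐ[k] E) (hσ : ∀ s ∈ S, (σ s)′ = σ (s′)) (x : E) :
    (σ x)′ = σ (x′) := by
  have hx : x ∈ adjoin k S := hS ▸ mem_top
  induction hx using adjoin_induction with
  | mem x hx => exact hσ x hx
  | algebraMap x => simp [deriv_algebraMap]
  | add x y hx hy hx' hy' => simp [hx', hy']
  | inv x hx hx' => simp [Derivation.leibniz_inv, hx']
  | mul x y hx hy hx' hy' => simp [Derivation.leibniz, hx', hy']

/-- An algebraic antiderivative that produces no new constants is trivial. -/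
theorem mem_range_of_isAlgebraic [CharZero k] [Differential k] [Differential E]
    [DifferentialAlgebra k E] [Differential.ContainConstants k E] {x : E}
    (hx : x′ ∈ (algebraMap k E).range) (halg : IsAlgebraic k x) : x ∈ (algebraMap k E).range := by
  obtain ⟨v, hv⟩ := hx
  have hint : IsIntegral k x := halg.isIntegral
  set p := minpoly k x with hp
  have hmon : p.Monic := minpoly.monic hint
  have hdeg : 0 < p.natDegree := minpoly.natDegree_pos hint
  -- Differentiating `p(x) = 0` gives `q(x) = 0`. As `p` is monic, `q` has no term of degree `deg p`
  -- or more, so minimality forces `q = 0`.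
  set q : k[X] := Differential.mapCoeffs p + derivative p * C v with hq
  have hq0 : aeval x q = 0 := by
    have h := Differential.deriv_aeval_eq x p
    rw [hp, minpoly.aeval, map_zero, ← hp, ← hv] at h
    rw [hq, map_add, map_mul, aeval_C, ← h]
  have hcoeff : ∀ m, p.natDegree ≤ m → q.coeff m = 0 := by
    intro m hm
    rw [hq, coeff_add, Differential.coeff_mapCoeffs, coeff_mul_C, coeff_derivative,
      coeff_eq_zero_of_natDegree_lt (p := p) (n := m + 1) (by omega)]
    rcases hm.eq_or_lt with rfl | h
    · rw [hmon.coeff_natDegree]; simp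
    · rw [coeff_eq_zero_of_natDegree_lt h]; simp
  have hqz : q = 0 := by
    by_contra hne
    have h1 : p.natDegree ≤ q.natDegree := natDegree_le_natDegree (minpoly.degree_le_of_ne_zero k x hne hq0)
    exact hne (leadingCoeff_eq_zero.1 (hcoeff _ h1))
  obtain ⟨m, hm⟩ : ∃ m, p.natDegree = m + 1 := ⟨p.natDegree - 1, by omega⟩
  -- The coefficient just below the top makes `p_m + (m + 1) x` a constant, which can be solved for
  -- `x`.
  have h1 : (p.coeff m)′ + ((m : k) + 1) * v = 0 := by
    have h := congrArg (fun r => coeff r m) hqz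
    simp only [hq, coeff_add, Differential.coeff_mapCoeffs, coeff_mul_C, coeff_derivative,
      coeff_zero] at h
    rw [← hm, hmon.coeff_natDegree, one_mul] at h
    exact h
  have hm0 : ((m : k) + 1) ≠ 0 := by exact_mod_cast Nat.succ_ne_zero m
  have hmE : ((m : E) + 1)′ = 0 := by simp
  have hconst : (algebraMap k E (p.coeff m) + ((m : E) + 1) * x)′ = 0 := by
    have h2 := congrArg (algebraMap k E) h1
    simp only [map_add, map_mul, map_natCast, map_one, map_zero] at h2
    rw [map_add, deriv_algebraMap, Derivation.leibniz, hmE, smul_zero, add_zero, ← hv, smul_eq_mul,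
      h2]
  obtain ⟨c, hc⟩ := mem_range_of_deriv_eq_zero k hconst
  refine ⟨(c - p.coeff m) / ((m : k) + 1), ?_⟩
  have hm1 : algebraMap k E ((m : k) + 1) ≠ 0 := (_root_.map_ne_zero _).2 hm0
  rw [map_div₀, div_eq_iff hm1, map_sub, hc]
  simp only [map_add, map_natCast, map_one]
  ring

end Generic

/-! ### The shift `y ↦ y + 1` on `k(y)` -/

section Shift

variable {k E : Type*} [Field k] [Field E] [Algebra k E]

theorem map_aeval_of_fixed (σ : E →+* E) (hfix : ∀ z : k, σ (algebraMap k E z) = algebraMap k E z)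
    (y : E) (p : k[X]) : σ (aeval y p) = aeval (σ y) p := by
  rw [aeval_def, hom_eval₂, aeval_def]
  congr 1
  ext z
  exact hfix z

/-- A rational function that is invariant under a shift of its variable is constant. -/
theorem mem_range_of_shift_fixed [CharZero E] (σ : E →+* E)
    (hfix : ∀ z : k, σ (algebraMap k E z) = algebraMap k E z) {y : E} (hy : σ y = y + 1) {x : E}
    (hx : x ∈ adjoin k {y}) (hσx : σ x = x) : x ∈ (algebraMap k E).range := by
  obtain ⟨p, q, rfl⟩ := (mem_adjoin_simple_iff k x).1 hx
  set x := aeval y p / aeval y q with hxdef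
  by_cases hq : aeval y q = 0
  · rw [hxdef, hq, div_zero]; exact zero_mem _
  -- Iterating `σ` turns the single relation `x q(y) = p(y)` into infinitely many roots of `x q -
  -- p`. That polynomial therefore vanishes, and comparing top coefficients of `q` gives `x`.
  have hpoly : ∀ n : ℕ, x * aeval (y + n) q = aeval (y + n) p := by
    intro n
    induction n with
    | zero => rw [Nat.cast_zero, add_zero, hxdef, div_mul_cancel₀ _ hq]
    | succ n ih =>
      have h := congrArg σ ih
      rw [map_mul, hσx, map_aeval_of_fixed σ hfix, map_aeval_of_fixed σ hfix, map_add, hy,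
        map_natCast] at h
      rw [Nat.cast_succ, ← add_assoc, add_right_comm]
      exact h
  have hzero : C x * q.map (algebraMap k E) - p.map (algebraMap k E) = 0 := by
    refine eq_zero_of_infinite_isRoot _ (Set.Infinite.mono ?_ (Set.infinite_range_of_injective
      (f := fun n : ℕ => y + (n : E)) fun a b h => Nat.cast_injective (add_left_cancel h)))
    rintro _ ⟨n, rfl⟩
    simp only [Set.mem_ofPred_eq, IsRoot.def, eval_sub, eval_mul, eval_C, eval_map_algebraMap]
    rw [hpoly n, sub_self]
  have hq0 : q ≠ 0 := by rintro rfl; simp at hq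
  have h := congrArg (fun r => coeff r q.natDegree) hzero
  simp only [coeff_sub, coeff_C_mul, coeff_map, coeff_zero] at h
  have hl : algebraMap k E q.leadingCoeff ≠ 0 := (_root_.map_ne_zero _).2 (leadingCoeff_ne_zero.2 hq0)
  refine ⟨p.coeff q.natDegree / q.leadingCoeff, ?_⟩
  rw [map_div₀, div_eq_iff hl]
  exact (sub_eq_zero.1 h).symm

theorem exists_shift {y : E} (hy : Transcendental k y) (htop : adjoin k {y} = ⊤) :
    ∃ σ : E ≃ₐ[k] E, σ y = y + 1 := by
  let e : RatFunc k ≃ₐ[k] E := ((RatFunc.algEquivOfTranscendental y hy).trans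
    (IntermediateField.equivOfEq htop)).trans topEquiv
  let s : RatFunc k ≃ₐ[k] RatFunc k :=
    IsFractionRing.algEquivOfAlgEquiv (Polynomial.algEquivAevalXAddC (1 : k))
  have he : e RatFunc.X = y := by
    simp [e, RatFunc.algEquivOfTranscendental_X]
  have hs : s RatFunc.X = RatFunc.X + 1 := by
    rw [← RatFunc.algebraMap_X]
    rw [IsFractionRing.algEquivOfAlgEquiv_algebraMap]
    simp [Polynomial.algEquivAevalXAddC]
  refine ⟨(e.symm.trans s).trans e, ?_⟩
  have : e.symm y = RatFunc.X := by rw [← he, AlgEquiv.symm_apply_apply]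
  simp [this, hs, he]

variable [Differential k] [Differential E] [DifferentialAlgebra k E]

theorem exists_differential_shift {y : E} (hy : Transcendental k y) (htop : adjoin k {y} = ⊤)
    (hy' : y′ ∈ (algebraMap k E).range) :
    ∃ σ : E ≃ₐ[k] E, σ y = y + 1 ∧ ∀ x, (σ x)′ = σ (x′) := by
  obtain ⟨σ, hσ⟩ := exists_shift hy htop
  refine ⟨σ, hσ, deriv_map_of_adjoin_eq_top htop (σ : E →ₐ[k] E) ?_⟩
  rintro _ rfl
  obtain ⟨v, hv⟩ := hy'
  simp [hσ, ← hv]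

variable [CharZero k] [Differential.ContainConstants k E]

/-- The only antiderivatives in `k(y)`, with `y` an antiderivative, are `c y + b`. -/
theorem exists_const_mul_of_adjoin_eq_top {x y : E} (hy' : y′ ∈ (algebraMap k E).range)
    (hx' : x′ ∈ (algebraMap k E).range) (htop : adjoin k {y} = ⊤) :
    ∃ c : E, c′ = 0 ∧ x - c * y ∈ (algebraMap k E).range := by
  have : CharZero E := charZero_of_injective_algebraMap (algebraMap k E).injective
  by_cases hy : Transcendental k y
  · obtain ⟨σ, hσ, hd⟩ := exists_differential_shift hy htop hy'
    obtain ⟨v, hv⟩ := hx'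
    -- With `c = σ x - x` constant, `x - c y` is invariant under the shift.
    have hc : (σ x - x)′ = 0 := by
      rw [map_sub, hd, ← hv, σ.commutes, sub_self]
    obtain ⟨c, hcx⟩ := mem_range_of_deriv_eq_zero k hc
    refine ⟨σ x - x, hc, mem_range_of_shift_fixed (σ : E →+* E) (fun z => σ.commutes z) hσ
      (htop ▸ mem_top) ?_⟩
    have hc1 : σ x = x + algebraMap k E c := by rw [hcx]; ring
    change σ _ = _
    rw [← hcx, map_sub, map_mul, σ.commutes, hσ, hc1]
    ring
  · have hyr := mem_range_of_isAlgebraic hy' (not_not.1 hy)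
    refine ⟨0, map_zero _, ?_⟩
    have : adjoin k {y} = ⊥ := by
      rw [adjoin_simple_eq_bot_iff]
      exact hyr
    have hx : x ∈ (⊥ : IntermediateField k E) := by rw [← this, htop]; exact mem_top
    rw [zero_mul, sub_zero]
    exact hx

end Shift

/-! ### Antiderivatives in `k(y)`, relative to intermediate fields -/

section Antiderivatives

variable {k E : Type*} [Field k] [Field E] [Algebra k E] [CharZero k] [Differential k]
  [Differential E] [DifferentialAlgebra k E] [Differential.ContainConstants k E]

theorem exists_const_mul_of_mem_adjoin {x y : E} (hy' : y′ ∈ (algebraMap k E).range)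
    (hx' : x′ ∈ (algebraMap k E).range) (hx : x ∈ adjoin k {y}) :
    ∃ c : E, c′ = 0 ∧ x - c * y ∈ (algebraMap k E).range := by
  have hN : IsDifferentialSubfield (adjoin k {y}) := by
    refine isDifferentialSubfield_adjoin ?_
    rintro _ rfl
    obtain ⟨v, hv⟩ := hy'
    exact hv ▸ IntermediateField.algebraMap_mem _ _
  let := hN.toDifferential
  have hval : ∀ z : adjoin k {y}, ((z′ : adjoin k {y}) : E) = (z : E)′ := fun _ => rfl
  have : DifferentialAlgebra k (adjoin k {y}) :=
    ⟨fun a => Subtype.ext ((hval _).trans (deriv_algebraMap (B := E) a))⟩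
  have hrange : ∀ z : adjoin k {y}, (z : E) ∈ (algebraMap k E).range →
      z ∈ (algebraMap k (adjoin k {y})).range := by
    rintro z ⟨v, hv⟩
    exact ⟨v, Subtype.ext hv⟩
  have : Differential.ContainConstants k (adjoin k {y}) :=
    ⟨fun {z} hz => hrange z (mem_range_of_deriv_eq_zero k
      ((hval z).symm.trans (congrArg Subtype.val hz)))⟩
  obtain ⟨c, hc, b, hb⟩ := exists_const_mul_of_adjoin_eq_top (k := k)
    (x := (⟨x, hx⟩ : adjoin k {y})) (y := AdjoinSimple.gen k y) (hrange _ hy') (hrange _ hx')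
    (by
      refine IntermediateField.map_injective (adjoin k {y}).val ?_
      rw [adjoin_map, ← AlgHom.fieldRange_eq_map, fieldRange_val, Set.image_singleton]
      rfl)
  exact ⟨c, congrArg Subtype.val hc, b, congrArg Subtype.val hb⟩

end Antiderivatives

section Relative

variable {F E : Type*} [Field F] [Field E] [Algebra F E] [CharZero F]
  [Differential E] [Differential.ContainConstants F E]

theorem IsDifferentialSubfield.exists_const_mul {N : IntermediateField F E}
    (hN : IsDifferentialSubfield N) {x y : E} (hy' : y′ ∈ N) (hx' : x′ ∈ N)
    (hx : x ∈ adjoin N {y}) : ∃ c : E, c′ = 0 ∧ x - c * y ∈ N := by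
  let := hN.toDifferential
  have := hN.differentialAlgebra
  have := containConstants_intermediateField N
  obtain ⟨c, hc, b, hb⟩ := exists_const_mul_of_mem_adjoin (k := N) ⟨⟨_, hy'⟩, rfl⟩ ⟨⟨_, hx'⟩, rfl⟩ hx
  exact ⟨c, hc, hb ▸ b.2⟩

theorem IsDifferentialSubfield.transcendental {N : IntermediateField F E}
    (hN : IsDifferentialSubfield N) {x : E} (hx' : x′ ∈ N) (hx : x ∉ N) :
    Transcendental N x := by
  let := hN.toDifferential
  have := hN.differentialAlgebra
  have := containConstants_intermediateField N
  intro halg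
  obtain ⟨b, hb⟩ := mem_range_of_isAlgebraic (k := N) ⟨⟨_, hx'⟩, rfl⟩ halg
  exact hx (hb ▸ b.2)

end Relative

/-! ### Fixed elements of antiderivative extensions -/

section FixedField

variable {k E : Type*} [Field k] [Field E] [Algebra k E]

theorem mem_adjoin_insert_iff {S : Set E} {x y : E} :
    x ∈ adjoin k (insert y S) ↔ x ∈ adjoin (adjoin k S) {y} := by
  rw [← Set.union_singleton, ← adjoin_adjoin_left]
  rfl

variable [CharZero k] [Differential k] [Differential E] [DifferentialAlgebra k E]
  [Differential.ContainConstants k E]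

/-- For each generator `b`, `E` is a transcendental simple extension of the field `N` generated by
the others. Shifting `b` over `N` is a differential automorphism, so `b` can be removed from any set
of generators needed to express `x`. -/
theorem mem_range_of_fixed_of_independent [DecidableEq E] {S : Finset E}
    (hS : adjoin k (S : Set E) = ⊤) (hd : ∀ s ∈ S, s′ ∈ (algebraMap k E).range)
    (hind : ∀ b ∈ S, b ∉ adjoin k (S.erase b : Set E)) {x : E}
    (hx : ∀ σ : E ≃ₐ[k] E, (∀ y, (σ y)′ = σ (y′)) → σ x = x) : x ∈ (algebraMap k E).range := by
  have : CharZero E := charZero_of_injective_algebraMap (algebraMap k E).injective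
  have hdiff : ∀ T ⊆ S, IsDifferentialSubfield (adjoin k (T : Set E)) := by
    intro T hT
    refine isDifferentialSubfield_adjoin fun s hs => ?_
    obtain ⟨v, hv⟩ := hd s (hT hs)
    exact hv ▸ IntermediateField.algebraMap_mem _ _
  have key : ∀ T ⊆ S, x ∈ adjoin k (T : Set E) → x ∈ (algebraMap k E).range := by
    intro T
    induction T using Finset.induction_on with
    | empty =>
      intro _ h
      rw [Finset.coe_empty, adjoin_empty] at h
      exact h
    | insert b T hb ih =>
      intro hT h
      have hbS : b ∈ S := hT (Finset.mem_insert_self b T)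
      refine ih (fun t ht => hT (Finset.mem_insert_of_mem ht)) ?_
      rw [Finset.coe_insert, mem_adjoin_insert_iff] at h
      set N := adjoin k (S.erase b : Set E) with hNdef
      have hN : IsDifferentialSubfield N := hdiff _ (S.erase_subset b)
      let := hN.toDifferential
      have := hN.differentialAlgebra
      have hb' : b′ ∈ N := by
        obtain ⟨v, hv⟩ := hd b hbS
        exact hv ▸ N.algebraMap_mem _
      have htop : adjoin N {b} = ⊤ := by
        refine eq_top_iff.2 fun y _ => ?_
        rw [hNdef, ← mem_adjoin_insert_iff, ← Finset.coe_insert, Finset.insert_erase hbS, hS]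
        exact mem_top
      obtain ⟨σ, hσ, hσd⟩ := exists_differential_shift
        (hN.transcendental hb' (hind b hbS)) htop ⟨⟨_, hb'⟩, rfl⟩
      have hfix := hx (σ.restrictScalars k) hσd
      have hle : adjoin k (T : Set E) ≤ N := by
        refine adjoin.mono _ _ _ fun t ht => ?_
        exact Finset.mem_erase.2 ⟨fun hbt => hb (hbt ▸ ht), hT (Finset.mem_insert_of_mem ht)⟩
      obtain ⟨z, hz⟩ := mem_range_of_shift_fixed (k := adjoin k (T : Set E)) (σ : E →+* E)
        (fun z => σ.commutes ⟨z, hle z.2⟩) hσ h hfix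
      exact hz ▸ z.2
  exact key S subset_rfl (hS ▸ mem_top)

/-- The differential automorphisms of an antiderivative extension have no further fixed points. -/
theorem mem_range_of_fixed {S : Finset E}
    (hS : adjoin k (S : Set E) = ⊤) (hd : ∀ s ∈ S, s′ ∈ (algebraMap k E).range) {x : E}
    (hx : ∀ σ : E ≃ₐ[k] E, (∀ y, (σ y)′ = σ (y′)) → σ x = x) : x ∈ (algebraMap k E).range := by
  classical
  induction S using Finset.strongInduction with
  | H S ih =>
    by_cases hind : ∀ b ∈ S, b ∉ adjoin k (S.erase b : Set E)
    · exact mem_range_of_fixed_of_independent hS hd hind hx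
    · push Not at hind
      obtain ⟨b, hb, hmem⟩ := hind
      refine ih _ (Finset.erase_ssubset hb) ?_ fun s hs => hd s (Finset.mem_of_mem_erase hs)
      rw [eq_top_iff, ← hS, adjoin_le_iff]
      intro s hs
      by_cases hsb : s = b
      · exact hsb ▸ hmem
      · exact subset_adjoin _ _ (Finset.mem_erase.2 ⟨hsb, hs⟩)

end FixedField

/-! ### The group `G(E|K)` -/

section Galois

variable {F E : Type*} [Field F] [Field E] [Algebra F E] [CharZero F]
  [Differential E]

theorem mem_of_fixed {K : IntermediateField F E} (hK : IsDifferentialSubfield K)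
    (hEK : IsAntiderivativeExtension K E) {x : E} (hx : ∀ σ ∈ diffGal K, σ x = x) : x ∈ K := by
  classical
  obtain ⟨hc, n, ζ, hζ, htop⟩ := hEK
  let := hK.toDifferential
  have := hK.differentialAlgebra
  obtain ⟨z, hz⟩ := mem_range_of_fixed (k := K) (S := Finset.univ.image ζ) (x := x)
    (by rw [Finset.coe_image, Finset.coe_univ, Set.image_univ, htop])
    (by
      intro s hs
      obtain ⟨i, -, rfl⟩ := Finset.mem_image.1 hs
      exact hζ i)
    (fun σ hσ => hx (σ.restrictScalars F) ⟨fun y hy => σ.commutes ⟨y, hy⟩, hσ⟩)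
  exact hz ▸ z.2

omit [CharZero F] in
theorem diffGal_apply_sub_fixed {K : IntermediateField F E} {σ : E ≃ₐ[F] E} (hσ : σ ∈ diffGal K)
    {z : E} (hz : z′ ∈ K) : (σ z - z)′ = 0 := by
  rw [map_sub, hσ.2, hσ.1 _ hz, sub_self]

variable [Differential.ContainConstants F E]

omit [CharZero F] in
theorem diffGal_commute {K : IntermediateField F E} (hEK : IsAntiderivativeExtension K E)
    {σ τ : E ≃ₐ[F] E} (hσ : σ ∈ diffGal K) (hτ : τ ∈ diffGal K) : σ * τ = τ * σ := by
  obtain ⟨-, n, ζ, hζ, htop⟩ := hEK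
  ext x
  rw [AlgEquiv.mul_apply, AlgEquiv.mul_apply]
  have hx : x ∈ adjoin K (Set.range ζ) := htop ▸ mem_top
  induction hx using adjoin_induction with
  | mem x hx =>
    obtain ⟨i, rfl⟩ := hx
    obtain ⟨w, hw⟩ := hζ i
    have hi : (ζ i)′ ∈ K := hw ▸ w.2
    obtain ⟨a, ha⟩ := mem_range_of_deriv_eq_zero F (diffGal_apply_sub_fixed hσ hi)
    obtain ⟨b, hb⟩ := mem_range_of_deriv_eq_zero F (diffGal_apply_sub_fixed hτ hi)
    rw [← sub_add_cancel (τ (ζ i)) (ζ i), ← sub_add_cancel (σ (ζ i)) (ζ i), ← ha, ← hb,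
      map_add, map_add, σ.commutes, τ.commutes, ← sub_add_cancel (τ (ζ i)) (ζ i),
      ← sub_add_cancel (σ (ζ i)) (ζ i), ← ha, ← hb]
    ring
  | algebraMap z =>
    have h1 : σ (algebraMap K E z) = algebraMap K E z := hσ.1 _ z.2
    have h2 : τ (algebraMap K E z) = algebraMap K E z := hτ.1 _ z.2
    rw [h2, h1, h2]
  | add x y _ _ hx hy => rw [map_add, map_add, map_add, map_add, hx, hy]
  | inv x _ hx => rw [map_inv₀, map_inv₀, map_inv₀, map_inv₀, hx]
  | mul x y _ _ hx hy => rw [map_mul, map_mul, map_mul, map_mul, hx, hy]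

omit [CharZero F] in
/-- The orbit of an element under the powers of `σ` is given by a rational function of the
exponent. -/
theorem exists_rational_orbit {K : IntermediateField F E} (hEK : IsAntiderivativeExtension K E)
    {σ : E ≃ₐ[F] E} (hσ : σ ∈ diffGal K) (x : E) :
    ∃ P Q : E[X], ∀ n : ℕ, Q.eval (n : E) ≠ 0 ∧
      (σ ^ n) x * Q.eval (n : E) = P.eval (n : E) := by
  obtain ⟨-, n, ζ, hζ, htop⟩ := hEK
  have hx : x ∈ adjoin K (Set.range ζ) := htop ▸ mem_top
  have hpow : ∀ n : ℕ, σ ^ n ∈ diffGal K := fun n => pow_mem hσ n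
  induction hx using adjoin_induction with
  | mem x hx =>
    obtain ⟨i, rfl⟩ := hx
    obtain ⟨w, hw⟩ := hζ i
    have hi : (ζ i)′ ∈ K := hw ▸ w.2
    obtain ⟨a, ha⟩ := mem_range_of_deriv_eq_zero F (diffGal_apply_sub_fixed hσ hi)
    refine ⟨C (ζ i) + C (algebraMap F E a) * X, 1, fun n => ⟨by simp, ?_⟩⟩
    simp only [eval_one, mul_one, eval_add, eval_C, eval_mul, eval_X]
    induction n with
    | zero => simp
    | succ n ih =>
      rw [pow_succ', AlgEquiv.mul_apply, ih, map_add, map_mul, σ.commutes, map_natCast,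
        ← sub_add_cancel (σ (ζ i)) (ζ i), ← ha]
      push_cast
      ring
  | algebraMap z =>
    exact ⟨C (z : E), 1, fun n => ⟨by simp, by simpa using (hpow n).1 _ z.2⟩⟩
  | add x y _ _ hx hy =>
    obtain ⟨P, Q, h⟩ := hx
    obtain ⟨P', Q', h'⟩ := hy
    refine ⟨P * Q' + P' * Q, Q * Q', fun n => ⟨?_, ?_⟩⟩
    · rw [eval_mul]; exact mul_ne_zero (h n).1 (h' n).1
    · rw [map_add, eval_add, eval_mul, eval_mul, eval_mul, ← (h n).2, ← (h' n).2]
      ring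
  | inv x _ hx =>
    obtain ⟨P, Q, h⟩ := hx
    by_cases hx0 : x = 0
    · exact ⟨0, 1, fun n => by simp [hx0]⟩
    have hxn : ∀ n : ℕ, (σ ^ n) x ≠ 0 := fun n => (_root_.map_ne_zero _).2 hx0
    refine ⟨Q, P, fun n => ⟨?_, ?_⟩⟩
    · rw [← (h n).2]; exact mul_ne_zero (hxn n) (h n).1
    · rw [← (h n).2, map_inv₀, inv_mul_cancel_left₀ (hxn n)]
  | mul x y _ _ hx hy =>
    obtain ⟨P, Q, h⟩ := hx
    obtain ⟨P', Q', h'⟩ := hy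
    refine ⟨P * P', Q * Q', fun n => ⟨?_, ?_⟩⟩
    · rw [eval_mul]; exact mul_ne_zero (h n).1 (h' n).1
    · rw [map_mul, eval_mul, eval_mul, ← (h n).2, ← (h' n).2]
      ring

end Galois

/-! ### Unipotence -/

section Unipotent

/-- Comparing `n` with `n + 1` gives `U(X + 1) W = c W(X + 1) U` at all naturals, hence identically;
both products have the same leading coefficient up to `c`. -/
theorem eq_one_of_eval_eq_pow_mul {R : Type*} [Field R] [CharZero R] {U W : R[X]} {c : R}
    (hW : W.eval 0 ≠ 0) (h : ∀ n : ℕ, U.eval (n : R) = c ^ n * W.eval (n : R)) : c = 1 := by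
  have h0 : U.eval 0 ≠ 0 := by simpa using (h 0).trans_ne (by simpa using hW)
  have hWne : W ≠ 0 := by rintro rfl; simp at hW
  have hUne : U ≠ 0 := by rintro rfl; simp at h0
  have hcomp : U.comp (X + C 1) * W = C c * (W.comp (X + C 1) * U) := by
    refine eq_of_infinite_eval_eq _ _ (Set.Infinite.mono ?_
      (Set.infinite_range_of_injective (Nat.cast_injective (R := R))))
    rintro _ ⟨n, rfl⟩
    have h1 := h (n + 1)
    push_cast at h1
    simp only [Set.mem_ofPred_eq, eval_mul, eval_comp, eval_add, eval_X, eval_C, h1, h n]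
    ring
  have hl := congrArg leadingCoeff hcomp
  have hd : natDegree (X + C 1 : R[X]) ≠ 0 := by rw [natDegree_X_add_C]; exact one_ne_zero
  simp only [leadingCoeff_mul, leadingCoeff_comp hd, leadingCoeff_X_add_C, one_pow, mul_one,
    leadingCoeff_C] at hl
  have h2 : U.leadingCoeff * W.leadingCoeff ≠ 0 :=
    mul_ne_zero (leadingCoeff_ne_zero.2 hUne) (leadingCoeff_ne_zero.2 hWne)
  refine mul_right_cancel₀ h2 ?_
  rw [one_mul, mul_comm U.leadingCoeff, ← hl, mul_comm]

theorem exists_eval_eq_linearMap_eval {k E : Type*} [Field k] [Field E] [Algebra k E]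
    (l : E →ₗ[k] k) (P : E[X]) : ∃ R : k[X], ∀ n : ℕ, R.eval (n : k) = l (P.eval (n : E)) := by
  induction P using Polynomial.induction_on' with
  | add P Q hP hQ =>
    obtain ⟨R, hR⟩ := hP
    obtain ⟨S, hS⟩ := hQ
    exact ⟨R + S, fun n => by rw [eval_add, eval_add, map_add, hR, hS]⟩
  | monomial i a =>
    refine ⟨monomial i (l a), fun n => ?_⟩
    have : a * (n : E) ^ i = ((n : k) ^ i) • a := by
      rw [Algebra.smul_def, map_pow, map_natCast, mul_comm]
    rw [eval_monomial, eval_monomial, this, map_smul, smul_eq_mul, mul_comm]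

variable {F E : Type*} [Field F] [Field E] [Algebra F E] [CharZero F]
  [Differential E] [Differential.ContainConstants F E]

/-- Differential automorphisms of an antiderivative extension are unipotent: modulo an invariant
subfield their only eigenvalue is `1`. -/
theorem eigenvalue_eq_one {K : IntermediateField F E} (hEK : IsAntiderivativeExtension K E)
    {σ : E ≃ₐ[F] E} (hσ : σ ∈ diffGal K) {M : IntermediateField F E} (hM : ∀ x ∈ M, σ x ∈ M)
    {η : E} (hη : η ∉ M) {c : F} (hc : σ η - algebraMap F E c * η ∈ M) : c = 1 := by
  obtain ⟨P, Q, hPQ⟩ := exists_rational_orbit hEK hσ η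
  have hm : ∀ n : ℕ, (σ ^ n) η - algebraMap F E c ^ n * η ∈ M := by
    intro n
    induction n with
    | zero => simp
    | succ n ih =>
      have h1 := add_mem (hM _ ih) (mul_mem (pow_mem (M.algebraMap_mem c) n) hc)
      rw [map_sub, map_mul, map_pow, σ.commutes] at h1
      rw [pow_succ' σ, AlgEquiv.mul_apply]
      convert h1 using 1
      ring
  set q := Q.eval 0 with hq
  have hq0 : q ≠ 0 := by simpa using (hPQ 0).1
  -- Since `η ∉ M`, the vectors `q` and `q η` are independent over `M`; the functionals `l₁`, `l₂`
  -- are chosen to be dual to them up to nonzero scalars.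
  have hn1 : q ∉ Submodule.span M {q * η} := by
    rw [Submodule.mem_span_singleton]
    rintro ⟨a, ha⟩
    have ha' : (a : E) * (q * η) = q := ha
    have h1 : (a : E) * η = 1 := mul_left_cancel₀ hq0 (by linear_combination ha')
    exact hη (by rw [eq_inv_of_mul_eq_one_right h1]; exact inv_mem a.2)
  have hn2 : q * η ∉ Submodule.span M {q} := by
    rw [Submodule.mem_span_singleton]
    rintro ⟨a, ha⟩
    have ha' : (a : E) * q = q * η := ha
    have h1 : (a : E) = η := mul_left_cancel₀ hq0 (by linear_combination ha')
    exact hη (h1 ▸ a.2)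
  obtain ⟨l₁, h11, h12⟩ := Submodule.exists_le_ker_of_notMem hn1
  obtain ⟨l₂, h21, h22⟩ := Submodule.exists_le_ker_of_notMem hn2
  have h12' : l₁ (q * η) = 0 := h12 (Submodule.mem_span_singleton_self _)
  have h22' : l₂ q = 0 := h22 (Submodule.mem_span_singleton_self _)
  obtain ⟨A₁, hA₁⟩ := exists_eval_eq_linearMap_eval l₁ P
  obtain ⟨A₂, hA₂⟩ := exists_eval_eq_linearMap_eval l₂ P
  obtain ⟨B₁, hB₁⟩ := exists_eval_eq_linearMap_eval l₁ (Q * C η)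
  obtain ⟨B₂, hB₂⟩ := exists_eval_eq_linearMap_eval l₂ (Q * C η)
  obtain ⟨D₁, hD₁⟩ := exists_eval_eq_linearMap_eval l₁ Q
  obtain ⟨D₂, hD₂⟩ := exists_eval_eq_linearMap_eval l₂ Q
  have hrel : ∀ (n : ℕ) (l : E →ₗ[M] M), l (P.eval (n : E)) =
      algebraMap F M c ^ n * l ((Q * C η).eval (n : E)) + ⟨_, hm n⟩ * l (Q.eval (n : E)) := by
    intro n l
    have h1 : P.eval (n : E) = algebraMap F M c ^ n • ((Q * C η).eval (n : E)) +
        (⟨_, hm n⟩ : M) • Q.eval (n : E) := by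
      rw [← (hPQ n).2, eval_mul, eval_C]
      change _ = algebraMap F E c ^ n * (Q.eval (n : E) * η) +
        ((σ ^ n) η - algebraMap F E c ^ n * η) * Q.eval (n : E)
      ring
    rw [h1, map_add, map_smul, map_smul, smul_eq_mul, smul_eq_mul]
  have hfinal : algebraMap F M c = 1 := by
    -- Applying `l₁` and `l₂` to the orbit relation gives two equations with the same unknown
    -- element of `M`. These `2 × 2` determinants eliminate it, leaving only the factor `c ^ n`.
    refine eq_one_of_eval_eq_pow_mul (U := A₁ * D₂ - A₂ * D₁) (W := B₁ * D₂ - B₂ * D₁) ?_ ?_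
    · have b1 := hB₁ 0
      have b2 := hB₂ 0
      have d1 := hD₁ 0
      have d2 := hD₂ 0
      simp only [Nat.cast_zero, eval_mul, eval_C, ← hq] at b1 b2 d1 d2
      rw [eval_sub, eval_mul, eval_mul, b1, b2, d1, d2, h12', zero_mul, zero_sub]
      exact neg_ne_zero.2 (mul_ne_zero h21 h11)
    · intro n
      simp only [eval_sub, eval_mul, hA₁, hA₂, hB₁, hB₂, hD₁, hD₂, hrel n]
      ring
  exact (algebraMap F M).injective (hfinal.trans (map_one _).symm)

end Unipotent

/-! ### Common eigenvectors -/

section Eigenvector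

/-- Commuting endomorphisms of a nonzero finite-dimensional space have a common eigenvector. -/
theorem exists_common_eigenvector {C Q ι : Type*} [Field C] [IsAlgClosed C] [AddCommGroup Q]
    [Module C Q] (T : ι → Module.End C Q) (hT : ∀ i j, Commute (T i) (T j)) (W : Submodule C Q)
    [FiniteDimensional C W] (hW : W ≠ ⊥) (hWT : ∀ i, ∀ x ∈ W, T i x ∈ W) :
    ∃ v ∈ W, v ≠ 0 ∧ ∀ i, ∃ c : C, T i v = c • v := by
  let s : Set (Submodule C Q) := {U | U ≤ W ∧ U ≠ ⊥ ∧ ∀ i, ∀ x ∈ U, T i x ∈ U}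
  -- On a nonzero invariant subspace of least dimension every `T i` is scalar: an eigenspace of `T
  -- i` in it is invariant by commutation, hence is all of it.
  obtain ⟨U, ⟨hUW, hU0, hUT⟩, hmin⟩ := (measure fun U : Submodule C Q => Module.finrank C U).wf.has_min s
    ⟨W, le_rfl, hW, hWT⟩
  have : FiniteDimensional C U := Submodule.finiteDimensional_of_le hUW
  have : Nontrivial U := Submodule.nontrivial_iff_ne_bot.2 hU0
  obtain ⟨v, hvU, hv0⟩ := Submodule.exists_mem_ne_zero_of_ne_bot hU0
  refine ⟨v, hUW hvU, hv0, fun i => ?_⟩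
  obtain ⟨c, hc⟩ := Module.End.exists_eigenvalue ((T i).restrict (hUT i))
  obtain ⟨w, hw⟩ := hc.exists_hasEigenvector
  have hwi : T i w = c • (w : Q) := congrArg Subtype.val hw.apply_eq_smul
  let U' : Submodule C Q := U ⊓ LinearMap.ker (T i - algebraMap C (Module.End C Q) c)
  have hmem : ∀ x, x ∈ U' ↔ x ∈ U ∧ T i x = c • x := by
    intro x
    simp [U', LinearMap.mem_ker, sub_eq_zero, Module.algebraMap_end_apply]
  have hU's : U' ∈ s := by
    refine ⟨inf_le_left.trans hUW, ?_, ?_⟩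
    · rw [Submodule.ne_bot_iff]
      exact ⟨w, (hmem _).2 ⟨w.2, hwi⟩, fun h => hw.2 (Subtype.ext h)⟩
    · intro j x hx
      obtain ⟨hxU, hx⟩ := (hmem x).1 hx
      refine (hmem _).2 ⟨hUT j x hxU, ?_⟩
      have h1 := LinearMap.congr_fun (hT i j).eq x
      rw [Module.End.mul_apply, Module.End.mul_apply] at h1
      rw [h1, hx, map_smul]
  have hle : Module.finrank C U ≤ Module.finrank C U' := not_lt.1 (hmin U' hU's)
  have hUU' : U' = U := Submodule.eq_of_le_of_finrank_le inf_le_left hle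
  exact ⟨c, ((hmem v).1 (hUU' ▸ hvU)).2⟩

end Eigenvector

/-! ### Antiderivatives modulo an invariant subfield -/

section FixedModulo

variable {F E : Type*} [Field F] [Field E] [Algebra F E] [Differential F]

theorem constants_smul_eq_mul (c : constants F) (x : E) : c • x = algebraMap F E c * x :=
  Algebra.smul_def (c : F) x

theorem constants_smul_mem (N : IntermediateField F E) (c : constants F) {x : E} (hx : x ∈ N) :
    c • x ∈ N :=
  constants_smul_eq_mul c x ▸ mul_mem (N.algebraMap_mem (c : F)) hx

variable [Differential E] [DifferentialAlgebra F E]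

/-- The elements of `E` whose derivative lies in `M`, as a space over the constants of `F`. -/
def antiderivatives (M : IntermediateField F E) : Submodule (constants F) E where
  carrier := {x | x′ ∈ M}
  add_mem' := fun {x y} hx hy => by
    change (x + y)′ ∈ M
    rw [map_add]
    exact add_mem hx hy
  zero_mem' := by
    change (0 : E)′ ∈ M
    rw [map_zero]
    exact zero_mem M
  smul_mem' := fun c x hx => by
    have hc : (c : F)′ = 0 := c.2
    change (c • x)′ ∈ M
    rw [constants_smul_eq_mul, Derivation.leibniz, deriv_algebraMap, hc, map_zero, smul_zero, add_zero]
    exact mul_mem (M.algebraMap_mem _) hx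

/-- An intermediate field as a space over the constants of `F`. -/
def constantsSubmodule (M : IntermediateField F E) : Submodule (constants F) E where
  carrier := M
  add_mem' := add_mem
  zero_mem' := zero_mem M
  smul_mem' := fun c _ hx => constants_smul_mem M c hx

variable [CharZero F]

/-- Each `ζ` adds at most one dimension: over the preceding field, an antiderivative is a constant
multiple of `ζ` plus an element of that field. -/
theorem exists_finite_of_mem_adjoin [Differential.ContainConstants F E] {n : ℕ} {ζ : Fin n → E}
    (hζ : IsIteratedAntiderivatives F ζ) {M : IntermediateField F E}
    (hM : IsDifferentialSubfield M) (m : ℕ) (hm : m ≤ n) :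
    ∃ S : Submodule (constants F) E, FiniteDimensional (constants F) S ∧
      ∀ x ∈ antiderivatives M, x ∈ adjoin F ((M : Set E) ∪ ζ '' {j | (j : ℕ) < m}) →
        x ∈ constantsSubmodule M ⊔ S := by
  induction m with
  | zero =>
    refine ⟨⊥, inferInstance, fun x _ hx => ?_⟩
    simp only [Nat.not_lt_zero, Set.ofPred_false, Set.image_empty, Set.union_empty, adjoin_self] at hx
    exact Submodule.mem_sup_left hx
  | succ m ih =>
    obtain ⟨S, hS, hSx⟩ := ih (by omega)
    set N := adjoin F ((M : Set E) ∪ ζ '' {j | (j : ℕ) < m}) with hNdef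
    have hMN : M ≤ N := fun x hx => subset_adjoin _ _ (Or.inl hx)
    have hζN : ∀ i : Fin n, (i : ℕ) ≤ m → (ζ i)′ ∈ N := by
      intro i hi
      refine adjoin.mono _ _ _ ?_ (hζ i)
      refine (Set.image_mono fun j hj => ?_).trans Set.subset_union_right
      exact lt_of_lt_of_le (Fin.lt_def.1 hj) hi
    have hN : IsDifferentialSubfield N := by
      refine isDifferentialSubfield_adjoin ?_
      rintro x (hx | ⟨j, hj, rfl⟩)
      · exact hMN (hM x hx)
      · exact hζN j (le_of_lt hj)
    let i : Fin n := ⟨m, hm⟩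
    have hset : (M : Set E) ∪ ζ '' {j | (j : ℕ) < m + 1} =
        insert (ζ i) ((M : Set E) ∪ ζ '' {j | (j : ℕ) < m}) := by
      have : {j : Fin n | (j : ℕ) < m + 1} = insert i {j : Fin n | (j : ℕ) < m} := by
        ext j
        simp only [i, Set.mem_ofPred_eq, Set.mem_insert_iff, Fin.ext_iff]
        omega
      rw [this, Set.image_insert_eq, Set.union_insert]
    have hstep : ∀ x ∈ antiderivatives M,
        x ∈ adjoin F ((M : Set E) ∪ ζ '' {j | (j : ℕ) < m + 1}) →
        ∃ c : constants F, x - c • ζ i ∈ N := by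
      intro x hx hxm
      rw [hset, mem_adjoin_insert_iff] at hxm
      obtain ⟨c, hc, hcx⟩ := hN.exists_const_mul (hζN i le_rfl) (hMN hx) hxm
      obtain ⟨c, rfl⟩ := mem_range_of_deriv_eq_zero F hc
      rw [deriv_algebraMap, FaithfulSMul.algebraMap_eq_zero_iff] at hc
      exact ⟨⟨c, hc⟩, constants_smul_eq_mul (⟨c, hc⟩ : constants F) (ζ i) ▸ hcx⟩
    -- One `w` that really involves `ζ i` suffices: subtracting a constant multiple of it removes `ζ
    -- i` from any other antiderivative.
    by_cases hw : ∃ w ∈ antiderivatives M, ∃ d : constants F, d ≠ 0 ∧ w - d • ζ i ∈ N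
    · obtain ⟨w, hwV, d, hd, hwd⟩ := hw
      refine ⟨S ⊔ Submodule.span _ {w}, inferInstance, fun x hx hxm => ?_⟩
      obtain ⟨c, hc⟩ := hstep x hx hxm
      have h1 : x - (c * d⁻¹) • w ∈ N := by
        have h2 : x - (c * d⁻¹) • w = (x - c • ζ i) - (c * d⁻¹) • (w - d • ζ i) := by
          rw [smul_sub, smul_smul, inv_mul_cancel_right₀ hd]
          abel
        rw [h2]
        exact sub_mem hc (constants_smul_mem N _ hwd)
      have h3 := hSx _ (sub_mem hx (Submodule.smul_mem _ (c * d⁻¹) hwV)) h1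
      rw [← sub_add_cancel x ((c * d⁻¹) • w), ← sup_assoc]
      exact add_mem (Submodule.mem_sup_left h3) (Submodule.mem_sup_right
        (Submodule.smul_mem _ _ (Submodule.mem_span_singleton_self w)))
    · refine ⟨S, hS, fun x hx hxm => ?_⟩
      obtain ⟨c, hc⟩ := hstep x hx hxm
      by_cases hc0 : c = 0
      · rw [hc0, zero_smul, sub_zero] at hc
        exact hSx x hx hc
      · exact absurd ⟨x, hx, c, hc0, hc⟩ hw

/-- Modulo an invariant differential subfield there is an invariant antiderivative. -/
theorem exists_invariant_antiderivative (hC : IsAlgClosed (constants F))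
    (hE : IsIteratedAntiderivativeExtension F E) {K : IntermediateField F E}
    (hEK : IsAntiderivativeExtension K E) {M : IntermediateField F E}
    (hM : IsDifferentialSubfield M) (hinv : ∀ σ ∈ diffGal K, ∀ x ∈ M, σ x ∈ M) (hMtop : M ≠ ⊤) :
    ∃ η ∉ M, η′ ∈ M ∧ ∀ σ ∈ diffGal K, σ η - η ∈ M := by
  obtain ⟨hconst, n, ζ, hζ, htop⟩ := hE
  obtain ⟨S, hS, hSx⟩ := exists_finite_of_mem_adjoin hζ hM n le_rfl
  set Mc := constantsSubmodule M with hMc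
  set V := antiderivatives M with hV
  have hVS : V ≤ Mc ⊔ S := by
    intro x hx
    refine hSx x hx ?_
    have h1 : x ∈ adjoin F (Set.range ζ) := htop ▸ mem_top
    refine adjoin.mono _ _ _ ?_ h1
    rintro _ ⟨j, rfl⟩
    exact Or.inr ⟨j, j.2, rfl⟩
  let W : Submodule (constants F) (E ⧸ Mc) := V.map Mc.mkQ
  have hWfin : FiniteDimensional (constants F) W := by
    have hle : W ≤ S.map Mc.mkQ := by
      refine (Submodule.map_mono hVS).trans ?_
      rw [Submodule.map_sup, Mc.mkQ_map_self, bot_sup_eq]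
    exact Submodule.finiteDimensional_of_le hle
  have hWne : W ≠ ⊥ := by
    -- The first `ζ i` outside `M` has its derivative in `M`, so its class is nonzero.
    obtain ⟨i, hi⟩ : ∃ i, ζ i ∉ M ∧ ∀ j < i, ζ j ∈ M := by
      have hex : ∃ i, ζ i ∉ M := by
        by_contra! h
        refine hMtop (eq_top_iff.2 (htop ▸ adjoin_le_iff.2 ?_))
        rintro _ ⟨i, rfl⟩
        exact h i
      obtain ⟨i, hi, hmin⟩ := wellFounded_lt.has_min {i | ζ i ∉ M} hex
      exact ⟨i, hi, fun j hj => not_not.1 fun h => hmin j h hj⟩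
    have hiV : ζ i ∈ V := by
      refine (adjoin_le_iff.2 ?_ : adjoin F (ζ '' {j | j < i}) ≤ M) (hζ i)
      rintro _ ⟨j, hj, rfl⟩
      exact hi.2 j hj
    refine (Submodule.ne_bot_iff _).2 ⟨Mc.mkQ (ζ i), Submodule.mem_map_of_mem hiV, fun h => hi.1 ?_⟩
    exact (Submodule.Quotient.mk_eq_zero Mc).1 h
  let l : diffGal K → (E →ₗ[constants F] E) := fun σ =>
    ((σ : E ≃ₐ[F] E) : E →ₐ[F] E).toLinearMap.restrictScalars (constants F)
  have hl : ∀ (σ : diffGal K) (x : E), l σ x = (σ : E ≃ₐ[F] E) x := fun _ _ => rfl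
  let T : diffGal K → Module.End (constants F) (E ⧸ Mc) := fun σ =>
    Mc.mapQ Mc (l σ) fun x hx => hinv σ σ.2 x hx
  have hTx : ∀ (σ : diffGal K) (x : E), T σ (Mc.mkQ x) = Mc.mkQ ((σ : E ≃ₐ[F] E) x) :=
    fun _ _ => rfl
  obtain ⟨v, hvW, hv0, hv⟩ := exists_common_eigenvector T
    (by
      intro σ τ
      refine LinearMap.ext fun y => ?_
      obtain ⟨x, rfl⟩ := Mc.mkQ_surjective y
      rw [Module.End.mul_apply, Module.End.mul_apply, hTx, hTx, hTx, hTx]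
      exact congrArg _ (DFunLike.congr_fun (diffGal_commute hEK σ.2 τ.2) x))
    W hWne
    (by
      rintro σ _ ⟨x, hx, rfl⟩
      rw [hTx]
      refine Submodule.mem_map_of_mem ?_
      change ((σ : E ≃ₐ[F] E) x)′ ∈ M
      rw [σ.2.2]
      exact hinv σ σ.2 _ hx)
  obtain ⟨η, hηV, rfl⟩ := hvW
  have hηM : η ∉ M := fun h => hv0 ((Submodule.Quotient.mk_eq_zero Mc).2 h)
  refine ⟨η, hηM, hηV, fun σ hσ => ?_⟩
  obtain ⟨c, hc⟩ := hv ⟨σ, hσ⟩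
  rw [hTx, ← map_smul, ← sub_eq_zero, ← map_sub] at hc
  have hc' : σ η - c • η ∈ M := (Submodule.Quotient.mk_eq_zero Mc).1 hc
  rw [constants_smul_eq_mul] at hc'
  have h1 := eigenvalue_eq_one hEK hσ (hinv σ hσ) hηM hc'
  rwa [h1, map_one, one_mul] at hc'

end FixedModulo

/-! ### Building the invariant tower -/

section Existence

theorem snoc_image_lt {α : Type*} {n m : ℕ} (hm : m ≤ n) (η : Fin n → α) (x : α) :
    (Fin.snoc η x : Fin (n + 1) → α) '' {j | (j : ℕ) < m} = η '' {j | (j : ℕ) < m} := by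
  ext y
  constructor
  · rintro ⟨j, hj, rfl⟩
    have hj' : (j : ℕ) < m := hj
    refine ⟨⟨j, by omega⟩, hj, ?_⟩
    have : j = Fin.castSucc ⟨j, by omega⟩ := rfl
    conv_rhs => rw [this]
    rw [Fin.snoc_castSucc]
  · rintro ⟨j, hj, rfl⟩
    exact ⟨j.castSucc, hj, Fin.snoc_castSucc (α := fun _ => α) _ _ _⟩

theorem image_lt_eq_range {α : Type*} {n : ℕ} (η : Fin n → α) : η '' {j | (j : ℕ) < n} = Set.range η := by
  rw [← Set.image_univ]
  congr 1
  ext j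
  simp

variable {F E : Type*} [Field F] [Field E] [Algebra F E]

theorem map_mem_adjoin {S : Set E} {σ : E ≃ₐ[F] E} (h : ∀ s ∈ S, σ s ∈ adjoin F S) {x : E}
    (hx : x ∈ adjoin F S) : σ x ∈ adjoin F S := by
  have hle : adjoin F S ≤ (adjoin F S).comap (σ : E →ₐ[F] E) := adjoin_le_iff.2 h
  exact hle hx

theorem algebraicIndependent_snoc {n : ℕ} {η : Fin n → E} (hη : AlgebraicIndependent F η) {x : E}
    (hx : Transcendental (adjoin F (Set.range η)) x) :
    AlgebraicIndependent F (Fin.snoc η x : Fin (n + 1) → E) := by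
  have h1 : Transcendental (Algebra.adjoin F (Set.range η)) x :=
    transcendental_adjoin_iff.1 hx
  have h2 := (hη.option_iff_transcendental x).2 h1
  have h3 := h2.comp finSuccEquivLast finSuccEquivLast.injective
  convert h3 using 1
  ext i
  refine Fin.lastCases ?_ (fun j => ?_) i
  · simp [finSuccEquivLast_last]
  · simp

variable [Differential F] [Differential E] [DifferentialAlgebra F E]

theorem IsIteratedAntiderivatives.isDifferentialSubfield {n : ℕ} {η : Fin n → E}
    (hη : IsIteratedAntiderivatives F η) (m : ℕ) :
    IsDifferentialSubfield (adjoin F (η '' {j | (j : ℕ) < m})) := by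
  refine isDifferentialSubfield_adjoin ?_
  rintro _ ⟨i, hi, rfl⟩
  exact adjoin.mono _ _ _ (Set.image_mono fun j hj => lt_trans (Fin.lt_def.1 hj) hi) (hη i)

variable [CharZero F] [Differential.ContainConstants F E]

theorem IsInvariantIteratedAntiderivatives.snoc {H : Set (E ≃ₐ[F] E)} {n : ℕ} {η : Fin n → E}
    (hη : IsInvariantIteratedAntiderivatives H η) {x : E} (hx : x ∉ adjoin F (Set.range η))
    (hx' : x′ ∈ adjoin F (Set.range η)) (hσ : ∀ σ ∈ H, σ x - x ∈ adjoin F (Set.range η)) :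
    IsInvariantIteratedAntiderivatives H (Fin.snoc η x : Fin (n + 1) → E) where
  differential := hη.differential
  commute := hη.commute
  iterated := by
    intro i
    change _ ∈ adjoin F (_ '' {j : Fin (n + 1) | (j : ℕ) < (i : ℕ)})
    rw [snoc_image_lt (Nat.lt_succ_iff.1 i.2)]
    refine Fin.lastCases ?_ (fun j => ?_) i
    · rw [Fin.snoc_last, Fin.val_last, image_lt_eq_range]
      exact hx'
    · rw [Fin.snoc_castSucc]
      exact hη.iterated j
  algebraicIndependent := by
    refine algebraicIndependent_snoc hη.algebraicIndependent ?_
    have hN := hη.iterated.isDifferentialSubfield n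
    rw [image_lt_eq_range] at hN
    exact hN.transcendental hx' hx
  invariant := by
    intro m hm σ hσH y hy
    rcases Nat.lt_succ_iff_lt_or_eq.1 (Nat.lt_succ_of_le hm) with hlt | rfl
    · rw [snoc_image_lt (Nat.lt_succ_iff.1 hlt)] at hy ⊢
      exact hη.invariant m (Nat.lt_succ_iff.1 hlt) σ hσH y hy
    · rw [image_lt_eq_range] at hy ⊢
      have hle : adjoin F (Set.range η) ≤
          adjoin F (Set.range (Fin.snoc η x : Fin (n + 1) → E)) := by
        refine adjoin.mono _ _ _ ?_
        rintro _ ⟨j, rfl⟩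
        exact ⟨j.castSucc, Fin.snoc_castSucc (α := fun _ => E) _ _ _⟩
      refine map_mem_adjoin ?_ hy
      rintro _ ⟨i, rfl⟩
      refine Fin.lastCases ?_ (fun j => ?_) i
      · rw [Fin.snoc_last, ← sub_add_cancel (σ x) x]
        exact add_mem (hle (hσ σ hσH))
          (subset_adjoin _ _ ⟨Fin.last n, Fin.snoc_last (α := fun _ => E) _ _⟩)
      · rw [Fin.snoc_castSucc]
        have h1 := hη.invariant n le_rfl σ hσH (η j) (subset_adjoin _ _ ⟨j, j.2, rfl⟩)
        rw [image_lt_eq_range] at h1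
        exact hle h1

theorem exists_invariantIteratedAntiderivatives (hC : IsAlgClosed (constants F))
    (hE : IsIteratedAntiderivativeExtension F E) {K : IntermediateField F E}
    (hEK : IsAntiderivativeExtension K E) :
    ∃ (t : ℕ) (η : Fin t → E),
      IsInvariantIteratedAntiderivatives (diffGal K : Set (E ≃ₐ[F] E)) η ∧
      adjoin F (Set.range η) = ⊤ := by
  by_contra! hno
  -- If no tower reaches `E`, every tower extends, giving algebraically independent families of
  -- every length.
  have hall : ∀ r : ℕ, ∃ η : Fin r → E,
      IsInvariantIteratedAntiderivatives (diffGal K : Set (E ≃ₐ[F] E)) η := by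
    intro r
    induction r with
    | zero =>
      refine ⟨Fin.elim0, ⟨?_, ?_, fun i => i.elim0, ?_, ?_⟩⟩
      · intro σ hσ
        refine ⟨?_, hσ.2⟩
        rintro x hx
        obtain ⟨z, rfl⟩ := mem_bot.1 hx
        exact σ.commutes z
      · exact fun σ hσ τ hτ => diffGal_commute hEK hσ hτ
      · exact algebraicIndependent_empty_type_iff.2 (algebraMap F E).injective
      · intro m _ σ _ x hx
        refine map_mem_adjoin ?_ hx
        rintro _ ⟨i, -, -⟩
        exact i.elim0
    | succ r ih =>
      obtain ⟨η, hη⟩ := ih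
      have hN := hη.iterated.isDifferentialSubfield r
      have hinv := hη.invariant r le_rfl
      rw [image_lt_eq_range] at hN hinv
      obtain ⟨x, hx, hx', hσ⟩ := exists_invariant_antiderivative hC hE hEK hN hinv (hno r η hη)
      exact ⟨_, hη.snoc hx hx' hσ⟩
  obtain ⟨-, n, ζ, -, htop⟩ := hE
  have hfg : Algebra.EssFiniteType F E :=
    fg_top_iff.1 (htop ▸ fg_adjoin_of_finite (Set.finite_range ζ))
  obtain ⟨d, hd⟩ := Cardinal.lt_aleph0.1 (trdeg_lt_aleph0 F E)
  obtain ⟨η, hη⟩ := hall (d + 1)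
  have h1 := hη.algebraicIndependent.lift_cardinalMk_le_trdeg
  rw [hd] at h1
  simp only [Cardinal.mk_fin, Cardinal.lift_natCast, Nat.cast_le] at h1
  omega

end Existence

/-! ### Fixed polynomials in the last antiderivative -/

section Intersection

variable {F E : Type*} [Field F] [Field E] [Algebra F E] {L : IntermediateField F E}

theorem exists_map_comp_of_invariant {σ : E ≃ₐ[F] E} (hinv : ∀ x ∈ L, σ x ∈ L) {y : E}
    (hy : σ y - y ∈ L) : ∃ (s : L →+* L) (b : L), ∀ p : L[X],
      σ (aeval y p) = aeval y ((p.map s).comp (X + C b)) := by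
  let s : L →+* L := ((σ : E →+* E).comp (algebraMap L E)).codRestrict L fun x => hinv x x.2
  refine ⟨s, ⟨_, hy⟩, fun p => ?_⟩
  have h1 : aeval y (X + C (⟨_, hy⟩ : L)) = σ y := by
    rw [map_add, aeval_X, aeval_C]
    exact add_sub_cancel y (σ y)
  rw [aeval_comp, h1, aeval_def, aeval_def, eval₂_map]
  exact hom_eval₂ p (algebraMap L E) (σ : E →+* E) y

theorem eq_map_comp_of_fixed {y : E} (hy : Transcendental L y) {σ : E ≃ₐ[F] E} {s : L →+* L}
    {b : L} (hs : ∀ p : L[X], σ (aeval y p) = aeval y ((p.map s).comp (X + C b))) {R : L[X]} :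
    σ (aeval y R) = aeval y R ↔ (R.map s).comp (X + C b) = R := by
  rw [hs]
  exact (transcendental_iff_injective.1 hy).eq_iff

/-- On `L[y]`, `σ` acts on coefficients and translates the variable by an element of `L`; both
operations commute with the formal derivative. -/
theorem fixed_derivative {σ : E ≃ₐ[F] E} (hinv : ∀ x ∈ L, σ x ∈ L) {y : E}
    (hσy : σ y - y ∈ L) (hy : Transcendental L y) {R : L[X]} (hR : σ (aeval y R) = aeval y R) :
    σ (aeval y (derivative R)) = aeval y (derivative R) := by
  obtain ⟨s, b, hs⟩ := exists_map_comp_of_invariant hinv hσy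
  rw [eq_map_comp_of_fixed hy hs] at hR ⊢
  have h := congrArg derivative hR
  rw [derivative_comp, derivative_map] at h
  simpa using h

theorem exists_add_mem_of_fixed [CharZero F] {K : IntermediateField F E} {H : Set (E ≃ₐ[F] E)}
    (hK : ∀ x, (∀ σ ∈ H, σ x = x) → x ∈ K) (hinv : ∀ σ ∈ H, ∀ x ∈ L, σ x ∈ L) {y : E}
    (hσy : ∀ σ ∈ H, σ y - y ∈ L) (hy : Transcendental L y) {R : L[X]} (hR0 : 0 < R.natDegree)
    (hR : ∀ σ ∈ H, σ (aeval y R) = aeval y R) : ∃ a ∈ L, y + a ∈ K := by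
  obtain ⟨n, hn⟩ : ∃ n, R.natDegree = n + 1 := ⟨R.natDegree - 1, by omega⟩
  have hR' : ∀ σ ∈ H, σ (aeval y (derivative R)) = aeval y (derivative R) :=
    fun σ hσ => fixed_derivative (hinv σ hσ) (hσy σ hσ) hy (hR σ hσ)
  induction n generalizing R with
  | zero =>
    obtain ⟨α, hα, β, rfl⟩ := natDegree_eq_one.1 hn
    have h1 : (α : E) ∈ K := hK _ fun σ hσ => by simpa using hR' σ hσ
    have h2 : (α : E) * y + β ∈ K := hK _ fun σ hσ => by simpa using hR σ hσ
    have hα0 : (α : E) ≠ 0 := fun h => hα (Subtype.ext h)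
    refine ⟨β / α, div_mem β.2 α.2, ?_⟩
    have h3 := div_mem h2 h1
    rwa [add_div, mul_div_cancel_left₀ _ hα0] at h3
  | succ n ih =>
    have hd : (derivative R).natDegree = n + 1 := by
      rw [natDegree_derivative, hn]
      rfl
    exact ih (by omega) hR' hd fun σ hσ =>
      fixed_derivative (hinv σ hσ) (hσy σ hσ) hy (hR' σ hσ)

/-- A monic denominator `Q` of `u` of least degree is fixed: its image under `σ` is another monic
denominator of the same degree, and a nonzero difference would be one of smaller degree. -/
theorem exists_fixed_polynomial {H : Set (E ≃ₐ[F] E)} (hinv : ∀ σ ∈ H, ∀ x ∈ L, σ x ∈ L) {y : E}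
    (hσy : ∀ σ ∈ H, σ y - y ∈ L) (hy : Transcendental L y) {u : E} (hu : u ∈ adjoin L {y})
    (huL : u ∉ L) (hfix : ∀ σ ∈ H, σ u = u) :
    ∃ R : L[X], 0 < R.natDegree ∧ ∀ σ ∈ H, σ (aeval y R) = aeval y R := by
  have hinj : Function.Injective (aeval y : L[X] →ₐ[L] E) := transcendental_iff_injective.1 hy
  let I : Set L[X] := {Q | Q ≠ 0 ∧ ∃ P : L[X], u * aeval y Q = aeval y P}
  have hI : I.Nonempty := by
    obtain ⟨p, q, hpq⟩ := (mem_adjoin_simple_iff L u).1 hu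
    have hq : aeval y q ≠ 0 := by
      intro h
      rw [h, div_zero] at hpq
      exact huL (hpq ▸ zero_mem L)
    exact ⟨q, by rintro rfl; simp at hq, p, by rw [hpq, div_mul_cancel₀ _ hq]⟩
  obtain ⟨Q₀, ⟨hQ₀, P₀, hP₀⟩, hmin⟩ := (measure fun Q : L[X] => Q.natDegree).wf.has_min I hI
  set Q := Q₀ * C Q₀.leadingCoeff⁻¹ with hQdef
  set P := P₀ * C Q₀.leadingCoeff⁻¹ with hPdef
  have hmon : Q.Monic := monic_mul_leadingCoeff_inv hQ₀
  have hdeg : Q.natDegree = Q₀.natDegree := natDegree_mul_leadingCoeff_inv _ hQ₀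
  have hPQ : u * aeval y Q = aeval y P := by
    rw [hQdef, hPdef, map_mul, map_mul, ← hP₀, mul_assoc]
  have hQfix : ∀ σ ∈ H, σ (aeval y Q) = aeval y Q := by
    intro σ hσ
    obtain ⟨s, b, hs⟩ := exists_map_comp_of_invariant (hinv σ hσ) (hσy σ hσ)
    rw [eq_map_comp_of_fixed hy hs]
    set Q' := (Q.map s).comp (X + C b) with hQ'
    have hmon' : Q'.Monic := (hmon.map s).comp_X_add_C b
    have hdeg' : Q'.natDegree = Q.natDegree := by
      rw [hQ', natDegree_comp, natDegree_X_add_C, mul_one, natDegree_map]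
    by_contra hne
    have hne' : Q' - Q ≠ 0 := sub_ne_zero.2 hne
    have hmem : Q' - Q ∈ I := by
      refine ⟨hne', (P.map s).comp (X + C b) - P, ?_⟩
      have h1 := congrArg σ hPQ
      rw [map_mul, hfix σ hσ, hs, hs] at h1
      rw [map_sub, map_sub, mul_sub, h1, hPQ]
    refine hmin _ hmem ?_
    change (Q' - Q).natDegree < Q₀.natDegree
    rw [← hdeg, ← hdeg']
    refine natDegree_lt_natDegree hne' (degree_sub_lt_left ?_ hmon'.ne_zero ?_)
    · rw [degree_eq_natDegree hmon'.ne_zero, degree_eq_natDegree hmon.ne_zero, hdeg']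
    · rw [hmon'.leadingCoeff, hmon.leadingCoeff]
  -- If the denominator is trivial, `u` itself is the required polynomial in `y`.
  rcases Nat.eq_zero_or_pos Q.natDegree with h0 | hpos
  · have hQ1 : Q = 1 := eq_one_of_monic_natDegree_zero hmon h0
    rw [hQ1, map_one, mul_one] at hPQ
    refine ⟨P, Nat.pos_of_ne_zero fun hP => huL ?_, fun σ hσ => ?_⟩
    · rw [hPQ, eq_C_of_natDegree_eq_zero hP, aeval_C]
      exact (P.coeff 0).2
    · rw [← hPQ, hfix σ hσ]
  · exact ⟨Q, hpos, hQfix⟩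

variable [CharZero F] [Differential E] [Differential.ContainConstants F E]

/-- Both `y` and `σ y` are antiderivatives over `L` in `L(y)`, so `σ y = c y + b`; unipotence gives
`c = 1`. -/
theorem diffGal_apply_sub_mem {K : IntermediateField F E} (hEK : IsAntiderivativeExtension K E)
    (hL : IsDifferentialSubfield L) {σ : E ≃ₐ[F] E} (hσ : σ ∈ diffGal K)
    (hinv : ∀ x ∈ L, σ x ∈ L) {y : E} (hyL : y ∉ L) (hy' : y′ ∈ L) (htop : adjoin L {y} = ⊤) :
    σ y - y ∈ L := by
  obtain ⟨c, hc, hcy⟩ := hL.exists_const_mul (x := σ y) hy' (by rw [hσ.2]; exact hinv _ hy')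
    (htop ▸ mem_top)
  obtain ⟨c, rfl⟩ := mem_range_of_deriv_eq_zero F hc
  have h1 := eigenvalue_eq_one hEK hσ hinv hyL hcy
  rwa [h1, map_one, one_mul] at hcy

theorem le_or_exists_add_mem {K : IntermediateField F E} (hK : IsDifferentialSubfield K)
    (hEK : IsAntiderivativeExtension K E) (hL : IsDifferentialSubfield L)
    (hinv : ∀ σ ∈ diffGal K, ∀ x ∈ L, σ x ∈ L) {y : E} (hyL : y ∉ L) (hy' : y′ ∈ L)
    (htop : adjoin L {y} = ⊤) : K ≤ L ∨ ∃ a ∈ L, y + a ∈ K := by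
  refine or_iff_not_imp_left.2 fun hKL => ?_
  obtain ⟨u, huK, huL⟩ := SetLike.not_le_iff_exists.1 hKL
  have hy := hL.transcendental hy' hyL
  have hσy : ∀ σ ∈ (diffGal K : Set (E ≃ₐ[F] E)), σ y - y ∈ L := fun σ hσ =>
    diffGal_apply_sub_mem hEK hL hσ (hinv σ hσ) hyL hy' htop
  obtain ⟨R, hR0, hR⟩ := exists_fixed_polynomial (H := diffGal K) hinv hσy hy
    (u := u) (htop ▸ mem_top) huL fun σ hσ => hσ.1 u huK
  exact exists_add_mem_of_fixed (H := diffGal K) (fun x hx => mem_of_fixed hK hEK hx) hinv hσy hy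
    hR0 hR

end Intersection

/-! ### The differential field `F⟨u⟩` -/

section DiffAdjoin

variable {F E : Type*} [Field F] [Field E] [Algebra F E]

theorem notMem_adjoin_of_algebraicIndependent {ι : Type*} {η : ι → E}
    (hη : AlgebraicIndependent F η) {s : Set ι} {i : ι} (hi : i ∉ s) :
    η i ∉ adjoin F (η '' s) := by
  intro h
  have h1 : Transcendental (adjoin F (η '' s)) (η i) :=
    transcendental_adjoin_iff.2 (hη.transcendental_adjoin hi)
  exact h1 (isAlgebraic_algebraMap (⟨η i, h⟩ : adjoin F (η '' s)))

variable [Differential E]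

theorem diffAdjoin_le {N : IntermediateField F E} (hN : IsDifferentialSubfield N) {u : E}
    (hu : u ∈ N) : diffAdjoin F u ≤ N := by
  refine adjoin_le_iff.2 ?_
  rintro _ ⟨n, rfl⟩
  induction n with
  | zero => exact hu
  | succ n ih =>
    simp only [Function.iterate_succ', Function.comp_apply]
    exact hN _ ih

theorem isDifferentialSubfield_diffAdjoin [Differential F] [DifferentialAlgebra F E] (u : E) :
    IsDifferentialSubfield (diffAdjoin F u) := by
  refine isDifferentialSubfield_adjoin ?_
  rintro _ ⟨n, rfl⟩
  exact subset_adjoin _ _ ⟨n + 1, by simp only [Function.iterate_succ', Function.comp_apply]⟩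

end DiffAdjoin

end DiffField

theorem mainTheorem4 {F E : Type*} [Field F] [Field E] [CharZero F]
    [Differential F] [Differential E] [Algebra F E] [DifferentialAlgebra F E]
    (hC : IsAlgClosed (DiffField.constants F))
    (hE : DiffField.IsIteratedAntiderivativeExtension F E)
    (K : IntermediateField F E) (hK : DiffField.IsDifferentialSubfield K)
    (hEK : DiffField.IsAntiderivativeExtension K E) :
    (∃ (t : ℕ) (η : Fin t → E),
      DiffField.IsInvariantIteratedAntiderivatives
        (DiffField.diffGal K : Set (E ≃ₐ[F] E)) η ∧
      IntermediateField.adjoin F (Set.range η) = ⊤) ∧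
    ∀ (t : ℕ) (η : Fin t → E),
      DiffField.IsInvariantIteratedAntiderivatives
        (DiffField.diffGal K : Set (E ≃ₐ[F] E)) η →
      IntermediateField.adjoin F (Set.range η) = ⊤ →
      ∀ L : IntermediateField F E,
        L = IntermediateField.adjoin F (η '' {j | (j : ℕ) + 1 < t}) →
        (K ≤ L ∨ ∃ i : Fin t, (i : ℕ) + 1 = t ∧ ∃ a ∈ L, η i + a ∈ K) ∧
        ∀ i : Fin t, (i : ℕ) + 1 = t → ∀ a ∈ L, η i + a ∈ K →
          η i + a ∉ DiffField.diffAdjoin F ((η i)′ + a′) ∧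
          DiffField.IsDifferentialSubfield (DiffField.diffAdjoin F ((η i)′ + a′)) ∧
          DiffField.diffAdjoin F ((η i)′ + a′) < K := by
  have := hE.1
  refine ⟨DiffField.exists_invariantIteratedAntiderivatives hC hE hEK, ?_⟩
  rintro t η hη htop L rfl
  rcases t with _ | t
  -- For `t = 0` there are no generators, so `L` is already all of `E`.
  · refine ⟨Or.inl fun x _ => ?_, fun i => i.elim0⟩
    have hx : x ∈ IntermediateField.adjoin F (Set.range η) := htop ▸ IntermediateField.mem_top
    refine IntermediateField.adjoin.mono _ _ _ ?_ hx
    rintro _ ⟨i, -⟩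
    exact i.elim0
  have hset : {j : Fin (t + 1) | (j : ℕ) + 1 < t + 1} = {j : Fin (t + 1) | (j : ℕ) < t} := by
    ext j
    simp
  rw [hset]
  set L := IntermediateField.adjoin F (η '' {j : Fin (t + 1) | (j : ℕ) < t}) with hLdef
  have hL : DiffField.IsDifferentialSubfield L := hη.iterated.isDifferentialSubfield t
  have hlast : ∀ i : Fin (t + 1), (i : ℕ) + 1 = t + 1 → i = Fin.last t := fun i hi =>
    Fin.ext (by simpa using hi)
  have hyL : η (Fin.last t) ∉ L :=
    DiffField.notMem_adjoin_of_algebraicIndependent hη.algebraicIndependent (by simp)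
  have hy' : (η (Fin.last t))′ ∈ L := hη.iterated (Fin.last t)
  have hLtop : IntermediateField.adjoin L {η (Fin.last t)} = ⊤ := by
    refine eq_top_iff.2 fun x _ => ?_
    have hx : x ∈ IntermediateField.adjoin F (Set.range η) := htop ▸ IntermediateField.mem_top
    rw [hLdef, ← DiffField.mem_adjoin_insert_iff, ← Set.image_insert_eq]
    refine IntermediateField.adjoin.mono _ _ _ ?_ hx
    rintro _ ⟨i, rfl⟩
    refine ⟨i, ?_, rfl⟩
    rcases Nat.lt_succ_iff_lt_or_eq.1 i.2 with h | h
    · exact Or.inr h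
    · exact Or.inl (Fin.ext h)
  refine ⟨?_, ?_⟩
  · refine (DiffField.le_or_exists_add_mem hK hEK hL
      (fun σ hσ => hη.invariant t (Nat.le_succ t) σ hσ) hyL hy' hLtop).imp_right fun h => ?_
    exact ⟨Fin.last t, by simp, h⟩
  · intro i hi a ha hia
    obtain rfl := hlast i hi
    have hleL : DiffField.diffAdjoin F ((η (Fin.last t))′ + a′) ≤ L :=
      DiffField.diffAdjoin_le hL (add_mem hy' (hL a ha))
    have hnot : η (Fin.last t) + a ∉ DiffField.diffAdjoin F ((η (Fin.last t))′ + a′) := by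
      intro h
      have h1 := sub_mem (hleL h) ha
      rw [add_sub_cancel_right] at h1
      exact hyL h1
    refine ⟨hnot, DiffField.isDifferentialSubfield_diffAdjoin _, ?_⟩
    refine lt_of_le_of_ne (DiffField.diffAdjoin_le hK ?_) fun h => hnot (h ▸ hia)
    rw [← map_add]
    exact hK _ hia
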